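/- Let $d\ge 1$ and let $(X,\mu)$ be a $\sigma$-finite measure space with $\mu(X)=\infty$. A measure-preserving $\mathbb Z^d$-action $\mathcal T=\{T^{v}\}_{v\in\mathbb Z^d}$ on $(X,\mu)$ is a family of invertible measurable, measure-preserving transformations such that for a.e. $x$ one has $T^0x=x$ and $T^{v+w}x=T^vT^wx$ for all $v,w$. It is *conservative* if for every measurable $A$ of positive measure there is $v\ne 0$ with positive measure of $T^vA\cap A$. It is *squarely ergodic* if there are positive integers $a_1,\dots,a_d$ such that for every nonzero vector $v=(c_1a_1,\dots,c_da_d)$ with all $c_i\in\{-1,0,1\}$ the transformation $T^{u}$, $u=v/\gcd(v_1,\dots,v_d)$, is ergodic. The product of two actions is $(T\times S)^v(x,y)=(T^vx,S^vy)$, with the product measure. A *skyscraper $\mathbb Z^d$-action* (a particular kind of rank-one action) is built as follows from positive integers $a_1,\dots,a_d$ and $h_0=1$, $h_{n+1}\ge 2h_n$. Put $\ell_{0,i}=1$ and $\ell_{n,i}=a_ih_n$ for $n\ge 1$. The grid $G_n$ assigns to the locations $x\in\mathbb Z^d$ with $0\le x_i<\ell_{n,i}$ pairwise disjoint half-open intervals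 of $\mathbb R$ of length $2^{-dn}$, called levels. $G_0$ assigns $[0,1)$ to the origin. To pass from $G_n$ to $G_{n+1}$, each level of $G_n$, at location $x$ say, is cut into $2^d$ subintervals $I_0,\dots,I_{2^d-1}$ of equal length, numbered from left to right, and $I_j$ with $j=\sum_{k=1}^{d} b_k2^{k-1}$, $b_k\in\{0,1\}$, is placed at location $x+(b_1\ell_{n,1},\dots,b_d\ell_{n,d})$; the remaining locations of $G_{n+1}$ receive new, disjoint spacer intervals. The $i$-th grid map of $G_n$ translates the level at $x$ onto the level at $x+e_i$, whenever both are locations of $G_n$. The skyscraper action is the measure-preserving $\mathbb Z^d$-action $\mathcal S$ on the union of all levels of all grids, with Lebesgue measure, for which $S^{e_i}$ is a.e. the pointwise limit of the $i$-th grid maps as $n\to\infty$, for $i=1,\dots,d$. **Theorem.** Let $\mathcal T$ be a measure-preserving $\mathbb Z^d$-action on $(X,\mu)$, with $\mu(X)=\infty$, that is squarely ergodic. Then there exists a (rank-one) skyscraper $\mathbb Z^d$-action $\mathcal S$ such that the product action $\mathcal T\times\mathcal S$ is not conservative. -/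

import Mathlib

open MeasureTheory Filter

/-- A measure-preserving action of `ℤ^d` on `(X, μ)`: a family of invertible measurable,
measure-preserving transformations satisfying the action laws almost everywhere.
(`ℤ^d` is countable and discrete, so joint measurability is automatic.) -/
structure MPAction (d : ℕ) {X : Type*} [MeasurableSpace X] (μ : Measure X) where
  /-- the transformation `T^v` -/
  map : (Fin d → ℤ) → X ≃ᵐ X
  measurePreserving : ∀ v, MeasurePreserving (map v) μ μ
  map_zero : ∀ᵐ x ∂μ, map 0 x = x
  map_add : ∀ v w, ∀ᵐ x ∂μ, map (v + w) x = map v (map w x)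

namespace MPAction

/-- The product action `(T × S)^v (x, y) = (T^v x, S^v y)`. -/
def prod {d : ℕ} {X Y : Type*} [MeasurableSpace X] [MeasurableSpace Y]
    {μ : Measure X} {ν : Measure Y} [SFinite μ] [SFinite ν]
    (T : MPAction d μ) (S : MPAction d ν) : MPAction d (μ.prod ν) where
  map v := (T.map v).prodCongr (S.map v)
  measurePreserving v := (T.measurePreserving v).prod (S.measurePreserving v)
  map_zero := by
    filter_upwards [Measure.quasiMeasurePreserving_fst.ae T.map_zero,
      Measure.quasiMeasurePreserving_snd.ae S.map_zero] with z h1 h2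
    exact Prod.ext h1 h2
  map_add v w := by
    filter_upwards [Measure.quasiMeasurePreserving_fst.ae (T.map_add v w),
      Measure.quasiMeasurePreserving_snd.ae (S.map_add v w)] with z h1 h2
    exact Prod.ext h1 h2

/-- An action is conservative if every measurable set of positive measure meets one of its
translates by a *nonzero* element of `ℤ^d` in a set of positive measure. -/
def Conservative {d : ℕ} {X : Type*} [MeasurableSpace X] {μ : Measure X}
    (T : MPAction d μ) : Prop :=
  ∀ A : Set X, MeasurableSet A → 0 < μ A →
    ∃ v : Fin d → ℤ, v ≠ 0 ∧ 0 < μ (T.map v '' A ∩ A)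

end MPAction

/-- The set `E` of all vectors `(c₁ a₁, …, c_d a_d)` with every `cᵢ ∈ {-1, 0, 1}`. -/
def squareVectors {d : ℕ} (a : Fin d → ℕ) : Set (Fin d → ℤ) :=
  {v | ∃ c : Fin d → ℤ, (∀ i, c i = -1 ∨ c i = 0 ∨ c i = 1) ∧ ∀ i, v i = c i * (a i : ℤ)}

/-- The vector `u_v = v / gcd(v₁, …, v_d)`; the division is exact. -/
def primitiveVector {d : ℕ} (v : Fin d → ℤ) : Fin d → ℤ :=
  fun i => v i / Finset.univ.gcd v

namespace MPAction

/-- Square ergodicity with respect to `a₁, …, a_d`: every `T^{u_v}`, for `v` a nonzero vector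
of `E`, is an ergodic transformation. -/
def SquarelyErgodicWrt {d : ℕ} {X : Type*} [MeasurableSpace X] {μ : Measure X}
    (T : MPAction d μ) (a : Fin d → ℕ) : Prop :=
  ∀ v ∈ squareVectors a, v ≠ 0 → Ergodic (T.map (primitiveVector v)) μ

/-- Square ergodicity: square ergodicity with respect to some positive integers. -/
def SquarelyErgodic {d : ℕ} {X : Type*} [MeasurableSpace X] {μ : Measure X}
    (T : MPAction d μ) : Prop :=
  ∃ a : Fin d → ℕ, (∀ i, 0 < a i) ∧ T.SquarelyErgodicWrt a

end MPAction

/-- The box `{x ∈ ℤ^d : 0 ≤ xᵢ < ℓᵢ for each i}`. -/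
def box {d : ℕ} (l : Fin d → ℕ) : Set (Fin d → ℤ) :=
  {x | ∀ i, 0 ≤ x i ∧ x i < (l i : ℤ)}

/-- The side lengths of the grids: the initial grid is a single interval, and for `n ≥ 1` the
`n`-th grid has side lengths `a₁ hₙ, …, a_d hₙ`. -/
def gridDims {d : ℕ} (a : Fin d → ℕ) (h : ℕ → ℕ) : ℕ → Fin d → ℕ
  | 0 => fun _ => 1
  | n + 1 => fun i => a i * h (n + 1)

/-- The cutting-and-stacking data of a skyscraper `ℤ^d`-action. The `n`-th grid assigns to each
location `x` in the box of side lengths `gridDims a h n` the half-open interval of length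
`2^{-dn}` with left endpoint `left n x`; values of `left` outside the box play no role. -/
structure SkyscraperGrids (d : ℕ) where
  a : Fin d → ℕ
  a_pos : ∀ i, 0 < a i
  h : ℕ → ℕ
  h_zero : h 0 = 1
  h_succ : ∀ n, 2 * h n ≤ h (n + 1)
  /-- left endpoint of the level at a given location of the `n`-th grid -/
  left : ℕ → (Fin d → ℤ) → ℝ
  /-- the initial grid is the interval `[0, 1)` placed at the origin -/
  left_zero : left 0 0 = 0
  /-- Each level of the `n`-th grid is cut into `2^d` subintervals of equal length, numbered from
  left to right by `j = ∑ₖ bₖ 2ᵏ`, `bₖ ∈ {0, 1}`; if the level was at location `x`, its `j`-th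
  piece is the level of the next grid at location `x + (b₁ ℓ₁, …, b_d ℓ_d)`, where the `ℓₖ` are
  the side lengths of the `n`-th grid. The other levels of the next grid are spacers. -/
  left_succ : ∀ n, ∀ x ∈ box (gridDims a h n), ∀ b : Fin d → Fin 2,
    left (n + 1) (fun k => x k + ((b k : ℕ) : ℤ) * (gridDims a h n k : ℤ)) =
      left n x + (∑ k : Fin d, ((b k : ℕ) : ℝ) * 2 ^ (k : ℕ)) * (1 / 2 ^ (d * (n + 1)))
  /-- the levels of a grid are pairwise disjoint; so new spacers are disjoint from one another
  and from everything used before -/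
  disjoint : ∀ n, (box (gridDims a h n)).PairwiseDisjoint
    fun x => Set.Ico (left n x) (left n x + 1 / 2 ^ (d * n))

namespace SkyscraperGrids

/-- The locations of the `n`-th grid. -/
def locations {d : ℕ} (G : SkyscraperGrids d) (n : ℕ) : Set (Fin d → ℤ) :=
  box (gridDims G.a G.h n)

/-- The level of the `n`-th grid at location `x`. -/
def level {d : ℕ} (G : SkyscraperGrids d) (n : ℕ) (x : Fin d → ℤ) : Set ℝ :=
  Set.Ico (G.left n x) (G.left n x + 1 / 2 ^ (d * n))

/-- The space of the skyscraper action: the union of all levels of all grids. -/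
def space {d : ℕ} (G : SkyscraperGrids d) : Set ℝ :=
  ⋃ n, ⋃ x ∈ G.locations n, G.level n x

theorem measurableSet_space {d : ℕ} (G : SkyscraperGrids d) : MeasurableSet G.space :=
  MeasurableSet.iUnion fun _ =>
    MeasurableSet.biUnion (Set.to_countable _) fun _ _ => measurableSet_Ico

/-- Lebesgue measure on the space of a skyscraper action. -/
noncomputable def measure {d : ℕ} (G : SkyscraperGrids d) : Measure G.space :=
  Measure.comap ((↑) : G.space → ℝ) volume

instance sigmaFinite_measure {d : ℕ} (G : SkyscraperGrids d) : SigmaFinite G.measure := by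
  refine SigmaFinite.of_map G.measure measurable_subtype_coe.aemeasurable ?_
  rw [measure, map_comap_subtype_coe G.measurableSet_space]
  infer_instance

/-- The `i`-th grid map of the `n`-th grid is the partial map translating the level at a location
`x` onto the level at location `x + eᵢ`, when both are locations of the grid. The proposition says
that this map is defined at `y` and has the value `z` there. -/
def GridMap {d : ℕ} (G : SkyscraperGrids d) (n : ℕ) (i : Fin d) (y z : ℝ) : Prop :=
  ∃ x ∈ G.locations n, x + Pi.single i 1 ∈ G.locations n ∧ y ∈ G.level n x ∧
    z = y - G.left n x + G.left n (x + Pi.single i 1)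

/-- `S` is the skyscraper action given by the grids `G`: its basis transformations are (almost
everywhere) the pointwise limits of the grid maps. As the grid maps of a later grid extend those
of an earlier one, the limit is the eventual value. -/
def IsSkyscraperAction {d : ℕ} (G : SkyscraperGrids d)
    (S : MPAction d G.measure) : Prop :=
  ∀ i : Fin d, ∀ᵐ y : G.space ∂G.measure,
    ∀ᶠ n in atTop, G.GridMap n i (y : ℝ) (S.map (Pi.single i 1) y : ℝ)

end SkyscraperGrids

/-! In infinite measure an ergodic transformation has no nonzero invariant vector in `L²`, so by the
mean ergodic theorem the correlations `μ (A ∩ T^{-(w + n p)} A)` tend to zero in Cesàro mean, for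
`A` of finite measure, any fixed `w` and any nonzero square vector `p`. Finitely many pairs `(p, w)`
can be averaged together, so some arbitrarily large `n` makes all these correlations small at once
(`MPAction.exists_sum_returnMeasure_lt`).

In a skyscraper, the vectors `v ≠ 0` returning a point of the base level `I` of the grid 1 to `I`
are very sparse. Compare the two points in the first grid where their locations differ by `v`: the
last binary digits contribute `h (m + 1) • p` with `p` a nonzero square vector, and the earlier ones
an error `w` with `|wᵢ| ≤ 2 aᵢ h m` (`SkyscraperGrids.exists_eq_add_nsmul_of_moves`). The range of
`w` depends on `h m` only, so `h (m + 1)` can be chosen afterwards to make the sum of the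
corresponding correlations of `A` less than `δ m`, where `∑ δ m < μ A`.

The measures of all returns of `A ×ˢ I` to itself then add up to less than the measure of `A ×ˢ I`.
Deleting the returning points leaves a set of positive measure that never meets its translates. The
remaining work is to build grids with the prescribed heights and to show that their limit is a
measure-preserving action. -/

section Ergodic

/-! ### The mean ergodic theorem in infinite measure -/

open Topology

variable {X : Type*} [MeasurableSpace X] {μ : Measure X}

/-- In an infinite measure space an ergodic map has no nonzero invariant vector in `L²`. -/
theorem Ergodic.eq_zero_of_compMeasurePreserving_eq {τ : X → X} (hτ : Ergodic τ μ)
    (hμ : μ Set.univ = ⊤) {f : Lp ℝ 2 μ}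
    (hf : Lp.compMeasurePreserving τ hτ.toMeasurePreserving f = f) : f = 0 := by
  have h1 : (f : X → ℝ) ∘ τ =ᵐ[μ] f := by
    have := Lp.coeFn_compMeasurePreserving f hτ.toMeasurePreserving
    rw [hf] at this
    exact this.symm
  obtain ⟨c, hc⟩ := hτ.ae_eq_const_of_ae_eq_comp_ae (Lp.aestronglyMeasurable f) h1
  have hmem : MemLp (fun _ : X => c) 2 μ := (memLp_congr_ae hc).1 (Lp.memLp f)
  rw [memLp_const_iff (by norm_num) (by norm_num)] at hmem
  rcases hmem with h | h
  · subst h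
    exact (Lp.eq_zero_iff_ae_eq_zero).2 hc
  · simp [hμ] at h

/-- Von Neumann's theorem: the averages converge to the projection onto the fixed space, which is
trivial here. -/
theorem LinearIsometry.tendsto_birkhoffAverage_zero {E : Type*} [NormedAddCommGroup E]
    [InnerProductSpace ℝ E] [CompleteSpace E] (U : E →ₗᵢ[ℝ] E) (hU : ∀ x, U x = x → x = 0) (x : E) :
    Tendsto (birkhoffAverage ℝ U _root_.id · x) atTop (𝓝 0) := by
  have key := U.toContinuousLinearMap.tendsto_birkhoffAverage_orthogonalProjection
    U.norm_toContinuousLinearMap_le x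
  rwa [hU _ ((U.toContinuousLinearMap.eqLocus (1 : E →L[ℝ] E)).orthogonalProjectionOnto x).2]
    at key

/-- The measures are inner products of the indicator of `A` with the iterates of the indicator of
`B` under the Koopman isometry. -/
theorem Ergodic.tendsto_average_measure_inter_preimage {τ : X → X} (hτ : Ergodic τ μ)
    (hμ : μ Set.univ = ⊤) {A B : Set X} (hA : MeasurableSet A) (hB : MeasurableSet B)
    (hAμ : μ A ≠ ⊤) (hBμ : μ B ≠ ⊤) :
    Tendsto (fun N : ℕ => (N : ℝ)⁻¹ * ∑ n ∈ Finset.range N, μ.real (A ∩ τ^[n] ⁻¹' B))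
      atTop (𝓝 0) := by
  have hmp := hτ.toMeasurePreserving
  have key := (Lp.compMeasurePreservingₗᵢ (E := ℝ) (p := 2) ℝ τ hmp).tendsto_birkhoffAverage_zero
    (fun f hf => hτ.eq_zero_of_compMeasurePreserving_eq hμ hf) (indicatorConstLp 2 hB hBμ (1 : ℝ))
  have key2 := ((innerSL ℝ (indicatorConstLp 2 hA hAμ (1 : ℝ))).continuous.tendsto 0).comp key
  rw [map_zero] at key2
  refine key2.congr fun N => ?_
  have hit : ∀ n, (Lp.compMeasurePreservingₗᵢ (E := ℝ) (p := 2) ℝ τ hmp)^[n]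
      (indicatorConstLp 2 hB hBμ (1 : ℝ)) =
      indicatorConstLp 2 ((hmp.iterate n).measurable hB)
        (by rwa [(hmp.iterate n).measure_preimage hB.nullMeasurableSet]) (1 : ℝ) := by
    intro n
    rw [← Lp.indicatorConstLp_compMeasurePreserving hB hBμ (1 : ℝ) (hmp.iterate n),
      ← Lp.compMeasurePreserving_iterate]
    rfl
  simp only [Function.comp_apply, birkhoffAverage, birkhoffSum, id, map_smul, map_sum, hit,
    innerSL_apply_apply, L2.real_inner_indicatorConstLp_one_indicatorConstLp_one, smul_eq_mul]

/-- By nonnegativity, the sum over multiples of `g` is at most the full sum up to `g * N`, which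
costs only a factor `g`. This is needed because ergodicity is assumed for the primitive vector `u`,
not for its multiple `g • u`. -/
theorem tendsto_average_comp_mul {f : ℕ → ℝ} (hf : ∀ n, 0 ≤ f n)
    (h : Tendsto (fun N : ℕ => (N : ℝ)⁻¹ * ∑ n ∈ Finset.range N, f n) atTop (𝓝 0))
    {g : ℕ} (hg : 0 < g) :
    Tendsto (fun N : ℕ => (N : ℝ)⁻¹ * ∑ n ∈ Finset.range N, f (g * n)) atTop (𝓝 0) := by
  have h2 : Tendsto (fun N : ℕ => (g : ℝ) * (((g * N : ℕ) : ℝ)⁻¹ *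
      ∑ n ∈ Finset.range (g * N), f n)) atTop (𝓝 0) := by
    have := (h.comp (tendsto_id.const_mul_atTop' hg)).const_mul (g : ℝ)
    simpa using this
  refine squeeze_zero (fun N => mul_nonneg (by positivity) (Finset.sum_nonneg fun n _ => hf _)) (fun N => ?_) h2
  have hg' : (g : ℝ) ≠ 0 := by positivity
  have : (g : ℝ) * (((g * N : ℕ) : ℝ)⁻¹ * ∑ n ∈ Finset.range (g * N), f n) =
      (N : ℝ)⁻¹ * ∑ n ∈ Finset.range (g * N), f n := by
    push_cast
    rw [mul_inv, ← mul_assoc, ← mul_assoc, mul_inv_cancel₀ hg', one_mul]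
  rw [this]
  gcongr
  rw [← Finset.sum_image (f := f) (s := Finset.range N) (g := fun n => g * n)
    (fun a _ b _ hab => Nat.eq_of_mul_eq_mul_left hg hab)]
  refine Finset.sum_le_sum_of_subset_of_nonneg ?_ fun _ _ _ => hf _
  intro k hk
  obtain ⟨n, hn, rfl⟩ := Finset.mem_image.1 hk
  exact Finset.mem_range.2 (Nat.mul_lt_mul_of_pos_left (Finset.mem_range.1 hn) hg)

/-- A nonnegative sequence whose averages tend to zero takes arbitrarily small values
arbitrarily far out. -/
theorem exists_ge_lt_of_tendsto_average {f : ℕ → ℝ} (hf : ∀ n, 0 ≤ f n)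
    (h : Tendsto (fun N : ℕ => (N : ℝ)⁻¹ * ∑ n ∈ Finset.range N, f n) atTop (𝓝 0))
    {ε : ℝ} (hε : 0 < ε) (M : ℕ) : ∃ n, M ≤ n ∧ f n < ε := by
  by_contra! hcon
  -- If all terms from `M` on were at least `ε`, the sum would be at least `(N - M) ε`, which
  -- exceeds `N ε / 2` once `N > 2 M`.
  have h1 := (h.eventually (gt_mem_nhds (half_pos hε))).and (eventually_ge_atTop (2 * M + 1))
  obtain ⟨N, hN1, hN2⟩ := h1.exists
  have h2 : ((N : ℝ) - M) * ε ≤ ∑ n ∈ Finset.range N, f n := by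
    have : ∑ n ∈ Finset.Ico M N, f n ≤ ∑ n ∈ Finset.range N, f n :=
      Finset.sum_le_sum_of_subset_of_nonneg (fun k hk => by simp at hk ⊢; omega)
        fun _ _ _ => hf _
    refine le_trans ?_ this
    have := Finset.card_nsmul_le_sum (Finset.Ico M N) f ε
      (fun n hn => hcon n (Finset.mem_Ico.1 hn).1)
    rwa [Nat.card_Ico, nsmul_eq_mul, Nat.cast_sub (by omega)] at this
  have hN : (0 : ℝ) < N := by exact_mod_cast (by omega : 0 < N)
  have h3 : ∑ n ∈ Finset.range N, f n < N * (ε / 2) := by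
    rwa [inv_mul_lt_iff₀ hN] at hN1
  have h4 : (2 * M + 1 : ℝ) ≤ N := by exact_mod_cast hN2
  nlinarith

end Ergodic

/-! ### Return measures along multiples of square vectors -/

namespace MPAction

variable {d : ℕ} {X : Type*} [MeasurableSpace X] {μ : Measure X}

theorem map_nsmul_ae (T : MPAction d μ) (u : Fin d → ℤ) (n : ℕ) :
    ∀ᵐ x ∂μ, T.map (n • u) x = (T.map u)^[n] x := by
  induction n with
  | zero => simpa using T.map_zero
  | succ n ih =>
    filter_upwards [T.map_add (n • u) u, (T.measurePreserving u).quasiMeasurePreserving.ae ih]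
      with x h1 h2
    rw [succ_nsmul, h1, h2, Function.iterate_succ_apply]

/-- `μ (A ∩ (T^v)⁻¹ A)`, the measure of the set of points of `A` that `T^v` returns to `A`. -/
noncomputable def returnMeasure (T : MPAction d μ) (A : Set X) (v : Fin d → ℤ) : ENNReal :=
  μ (A ∩ T.map v ⁻¹' A)

theorem returnMeasure_ne_top (T : MPAction d μ) {A : Set X} (hA : μ A ≠ ⊤) (v : Fin d → ℤ) :
    T.returnMeasure A v ≠ ⊤ :=
  measure_ne_top_of_subset Set.inter_subset_left hA

theorem returnMeasure_add_nsmul (T : MPAction d μ) (A : Set X) (u w : Fin d → ℤ) (n : ℕ) :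
    T.returnMeasure A (w + n • u) = μ (A ∩ (T.map u)^[n] ⁻¹' (T.map w ⁻¹' A)) := by
  refine measure_congr (ae_eq_set_inter ae_eq_rfl ?_)
  filter_upwards [T.map_add w (n • u), T.map_nsmul_ae u n] with x h1 h2
  refine propext ?_
  change T.map (w + n • u) x ∈ A ↔ T.map w ((T.map u)^[n] x) ∈ A
  rw [h1, h2]

-- The offset `w` is absorbed by taking the preimage of `A` under `T^w` as the second set.
open Topology in
theorem tendsto_average_returnMeasure (T : MPAction d μ) (hμ : μ Set.univ = ⊤)
    {u : Fin d → ℤ} (hu : Ergodic (T.map u) μ) {A : Set X} (hA : MeasurableSet A)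
    (hAμ : μ A ≠ ⊤) (w : Fin d → ℤ) {g : ℕ} (hg : 0 < g) :
    Tendsto (fun N : ℕ => (N : ℝ)⁻¹ *
      ∑ n ∈ Finset.range N, (T.returnMeasure A (w + n • g • u)).toReal) atTop (𝓝 0) := by
  have h := hu.tendsto_average_measure_inter_preimage hμ hA ((T.map w).measurable hA) hAμ
    (by rwa [(T.measurePreserving w).measure_preimage hA.nullMeasurableSet])
  refine (tendsto_average_comp_mul (fun _ => measureReal_nonneg) h hg).congr fun N => ?_
  congr 1
  refine Finset.sum_congr rfl fun n _ => ?_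
  rw [smul_smul, mul_comm n g, T.returnMeasure_add_nsmul, measureReal_def]

end MPAction

theorem exists_eq_nsmul_primitiveVector {d : ℕ} {v : Fin d → ℤ} (hv : v ≠ 0) :
    ∃ g : ℕ, 0 < g ∧ v = g • primitiveVector v := by
  have hdvd : ∀ i, Finset.univ.gcd v ∣ v i := fun i => Finset.gcd_dvd (Finset.mem_univ i)
  have hnn : 0 ≤ Finset.univ.gcd v := by
    rw [← Finset.normalize_gcd, ← Int.abs_eq_normalize]
    exact abs_nonneg _
  have hne : Finset.univ.gcd v ≠ 0 := by
    intro h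
    refine hv (funext fun i => ?_)
    have := hdvd i
    rw [h, zero_dvd_iff] at this
    exact this
  refine ⟨(Finset.univ.gcd v).natAbs, Int.natAbs_pos.2 hne, funext fun i => ?_⟩
  rw [Pi.smul_apply, nsmul_eq_mul, Int.natCast_natAbs, abs_of_nonneg hnn, primitiveVector,
    Int.mul_ediv_cancel' (hdvd i)]

namespace MPAction

variable {d : ℕ} {X : Type*} [MeasurableSpace X] {μ : Measure X}

/-- For a squarely ergodic action, suitable arbitrarily large multiples of all square vectors,
perturbed by finitely many vectors, almost fail to return a set to itself. -/
theorem exists_sum_returnMeasure_lt (T : MPAction d μ) (hμ : μ Set.univ = ⊤) {a : Fin d → ℕ}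
    (hT : T.SquarelyErgodicWrt a) {A : Set X} (hA : MeasurableSet A) (hAμ : μ A ≠ ⊤)
    (P F : Finset (Fin d → ℤ)) (hP : ∀ p ∈ P, p ∈ squareVectors a ∧ p ≠ 0)
    {ε : ENNReal} (hε : 0 < ε) (M : ℕ) :
    ∃ n, M ≤ n ∧ ∑ p ∈ P, ∑ w ∈ F, T.returnMeasure A (w + n • p) < ε := by
  obtain ⟨ε', hε'0, hε'⟩ := ENNReal.lt_iff_exists_real_btwn.1 hε
  have hε'1 : 0 < ε' := by simpa using hε'.1
  have htend : Filter.Tendsto (fun N : ℕ => (N : ℝ)⁻¹ * ∑ n ∈ Finset.range N,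
      ∑ p ∈ P, ∑ w ∈ F, (T.returnMeasure A (w + n • p)).toReal) Filter.atTop (nhds 0) := by
    have : Filter.Tendsto (fun N : ℕ => ∑ p ∈ P, ∑ w ∈ F, (N : ℝ)⁻¹ * ∑ n ∈ Finset.range N,
        (T.returnMeasure A (w + n • p)).toReal) Filter.atTop
        (nhds (∑ p ∈ P, ∑ w ∈ F, (0 : ℝ))) := by
      refine tendsto_finsetSum _ fun p hp => tendsto_finsetSum _ fun w _ => ?_
      obtain ⟨g, hg, hpg⟩ := exists_eq_nsmul_primitiveVector (hP p hp).2
      have := T.tendsto_average_returnMeasure hμ (hT p (hP p hp).1 (hP p hp).2) hA hAμ w hg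
      rwa [← hpg] at this
    simp only [Finset.sum_const_zero] at this
    refine this.congr fun N => ?_
    simp only [← Finset.mul_sum]
    congr 1
    rw [Finset.sum_comm]
    conv_rhs => rw [Finset.sum_comm]
    rw [Finset.sum_comm]
    refine Finset.sum_congr rfl fun p _ => ?_
    rw [Finset.sum_comm]
  obtain ⟨n, hn, hlt⟩ := exists_ge_lt_of_tendsto_average (fun n => Finset.sum_nonneg fun p _ =>
    Finset.sum_nonneg fun w _ => ENNReal.toReal_nonneg) htend hε'1 M
  refine ⟨n, hn, lt_trans ?_ hε'.2⟩
  have hne : ∀ v, T.returnMeasure A v ≠ ⊤ := T.returnMeasure_ne_top hAμ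
  rw [← ENNReal.toReal_lt_toReal (ENNReal.sum_ne_top.2 fun p _ => ENNReal.sum_ne_top.2
    fun w _ => hne _) ENNReal.ofReal_ne_top, ENNReal.toReal_ofReal hε'1.le,
    ENNReal.toReal_sum fun p _ => ENNReal.sum_ne_top.2 fun w _ => hne _]
  simpa only [ENNReal.toReal_sum fun w (_ : w ∈ F) => hne _] using hlt

end MPAction

/-! ### Binary digits of locations and existence of grids -/

section Digits

variable {d : ℕ}

/-- The location in the next grid, when the present grid has side lengths `l`, of the piece with
binary digits `b` of the level at location `x`. -/
def childLocation (l : Fin d → ℕ) (x : Fin d → ℤ) (b : Fin d → Fin 2) : Fin d → ℤ :=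
  fun k => x k + ((b k : ℕ) : ℤ) * (l k : ℤ)

theorem fin_two_val_eq (c : Fin 2) : (c = 0 ∧ ((c : ℕ) : ℤ) = 0) ∨ (c = 1 ∧ ((c : ℕ) : ℤ) = 1) := by
  fin_cases c <;> simp

theorem childLocation_inj {l : Fin d → ℕ} {x x' : Fin d → ℤ} {b b' : Fin d → Fin 2}
    (hx : x ∈ box l) (hx' : x' ∈ box l) (h : childLocation l x b = childLocation l x' b') :
    x = x' ∧ b = b' := by
  have key : ∀ k, x k = x' k ∧ b k = b' k := by
    intro k
    have h1 := congrFun h k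
    have h2 := hx k
    have h3 := hx' k
    simp only [childLocation] at h1
    rcases fin_two_val_eq (b k) with ⟨e1, e2⟩ | ⟨e1, e2⟩ <;>
    rcases fin_two_val_eq (b' k) with ⟨e3, e4⟩ | ⟨e3, e4⟩ <;>
    rw [e2, e4] at h1 <;> rw [e1, e3] <;> constructor <;> first | rfl | omega
  exact ⟨funext fun k => (key k).1, funext fun k => (key k).2⟩

theorem childLocation_mem_box {l l' : Fin d → ℕ} (hl : ∀ k, 2 * l k ≤ l' k) {x : Fin d → ℤ}
    (hx : x ∈ box l) (b : Fin d → Fin 2) : childLocation l x b ∈ box l' := by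
  intro k
  have h1 := hx k
  have h2 : (2 * l k : ℤ) ≤ l' k := by exact_mod_cast hl k
  simp only [childLocation]
  rcases fin_two_val_eq (b k) with ⟨-, e⟩ | ⟨-, e⟩ <;> rw [e] <;> omega

theorem gridDims_pos {a : Fin d → ℕ} (ha : ∀ i, 0 < a i) {h : ℕ → ℕ} (h0 : h 0 = 1)
    (hh : ∀ n, 2 * h n ≤ h (n + 1)) (n : ℕ) (i : Fin d) : 0 < gridDims a h n i := by
  have hpos : ∀ n, 0 < h n := by
    intro n
    induction n with
    | zero => omega
    | succ n ih => have := hh n; omega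
  cases n with
  | zero => exact one_pos
  | succ n => exact Nat.mul_pos (ha i) (hpos _)

theorem two_mul_gridDims_le {a : Fin d → ℕ} (ha : ∀ i, 0 < a i) {h : ℕ → ℕ} (h0 : h 0 = 1)
    (hh : ∀ n, 2 * h n ≤ h (n + 1)) (n : ℕ) (i : Fin d) :
    2 * gridDims a h n i ≤ gridDims a h (n + 1) i := by
  cases n with
  -- The side of the grid 0 is `1` and not `aᵢ h₀`, so this case is separate.
  | zero =>
    have h1 := hh 0
    rw [h0] at h1
    exact h1.trans (Nat.le_mul_of_pos_left _ (ha i))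
  | succ n =>
    have := Nat.mul_le_mul_left (a i) (hh (n + 1))
    simp only [gridDims]
    linarith

/-- The locations of a box, as a finite set. -/
noncomputable def boxFinset (l : Fin d → ℕ) : Finset (Fin d → ℤ) :=
  Fintype.piFinset fun k => Finset.Ico 0 (l k : ℤ)

theorem mem_boxFinset {l : Fin d → ℕ} {x : Fin d → ℤ} : x ∈ boxFinset l ↔ x ∈ box l := by
  simp [boxFinset, box]

open Classical in
/-- Left endpoints of the levels of explicit skyscraper grids, in units of `2^{-dn}`. -/
noncomputable def gridPosition (a : Fin d → ℕ) (h : ℕ → ℕ) : ℕ → (Fin d → ℤ) → ℕ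
  | 0, _ => 0
  | n + 1, y =>
    if hy : ∃ q : (Fin d → ℤ) × (Fin d → Fin 2),
        q.1 ∈ box (gridDims a h n) ∧ y = childLocation (gridDims a h n) q.1 q.2 then
      2 ^ d * gridPosition a h n hy.choose.1 + finFunctionFinEquiv hy.choose.2
    -- A spacer. The sum bounds every position in the previous grid, so this lies beyond all
    -- children; the code of `y` separates the spacers from one another.
    else 2 ^ d * (∑ x ∈ boxFinset (gridDims a h n), gridPosition a h n x + 1) + Encodable.encode y

theorem gridPosition_childLocation (a : Fin d → ℕ) (h : ℕ → ℕ) (n : ℕ) {x : Fin d → ℤ}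
    (hx : x ∈ box (gridDims a h n)) (b : Fin d → Fin 2) :
    gridPosition a h (n + 1) (childLocation (gridDims a h n) x b) =
      2 ^ d * gridPosition a h n x + finFunctionFinEquiv b := by
  have hex : ∃ q : (Fin d → ℤ) × (Fin d → Fin 2), q.1 ∈ box (gridDims a h n) ∧
      childLocation (gridDims a h n) x b = childLocation (gridDims a h n) q.1 q.2 :=
    ⟨(x, b), hx, rfl⟩
  have h1 := childLocation_inj hx hex.choose_spec.1 hex.choose_spec.2
  rw [gridPosition, dif_pos hex, ← h1.1, ← h1.2]

/-- For children, division by `2 ^ d` recovers the parent's position and the digits; spacers lie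
above all children and are told apart by their codes. -/
theorem gridPosition_injOn (a : Fin d → ℕ) (h : ℕ → ℕ) (n : ℕ) :
    Set.InjOn (gridPosition a h n) (box (gridDims a h n)) := by
  induction n with
  | zero =>
    intro x hx y hy _
    funext k
    have h1 := hx k
    have h2 := hy k
    simp only [gridDims] at h1 h2
    omega
  | succ n ih =>
    have hlt : ∀ (x : Fin d → ℤ) (b : Fin d → Fin 2), x ∈ box (gridDims a h n) →
        2 ^ d * gridPosition a h n x + (finFunctionFinEquiv b : ℕ) <
        2 ^ d * (∑ x ∈ boxFinset (gridDims a h n), gridPosition a h n x + 1) := by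
      intro x b hx
      have h1 : (finFunctionFinEquiv b : ℕ) < 2 ^ d := (finFunctionFinEquiv b).2
      have h2 : gridPosition a h n x ≤ ∑ x ∈ boxFinset (gridDims a h n), gridPosition a h n x :=
        Finset.single_le_sum (f := gridPosition a h n) (fun _ _ => Nat.zero_le _)
          (mem_boxFinset.2 hx)
      have h3 := Nat.mul_le_mul_left (2 ^ d) h2
      rw [mul_add, mul_one]
      omega
    intro y _ y' _ hyy
    by_cases hy : ∃ q : (Fin d → ℤ) × (Fin d → Fin 2),
        q.1 ∈ box (gridDims a h n) ∧ y = childLocation (gridDims a h n) q.1 q.2 <;>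
    by_cases hy' : ∃ q : (Fin d → ℤ) × (Fin d → Fin 2),
        q.1 ∈ box (gridDims a h n) ∧ y' = childLocation (gridDims a h n) q.1 q.2
    · obtain ⟨⟨x, b⟩, hx, rfl⟩ := hy
      obtain ⟨⟨x', b'⟩, hx', rfl⟩ := hy'
      dsimp only at hx hx' hyy ⊢
      rw [gridPosition_childLocation _ _ _ hx, gridPosition_childLocation _ _ _ hx'] at hyy
      have h1 : (finFunctionFinEquiv b : ℕ) < 2 ^ d := (finFunctionFinEquiv b).2
      have h2 : (finFunctionFinEquiv b' : ℕ) < 2 ^ d := (finFunctionFinEquiv b').2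
      have h3 : gridPosition a h n x = gridPosition a h n x' := by
        have := congrArg (· / 2 ^ d) hyy
        simpa only [Nat.mul_add_div (pow_pos two_pos d), Nat.div_eq_of_lt h1, Nat.div_eq_of_lt h2,
          add_zero] using this
      have h4 : b = b' := finFunctionFinEquiv.injective (Fin.ext (by rw [h3] at hyy; omega))
      rw [ih hx hx' h3, h4]
    · obtain ⟨⟨x, b⟩, hx, rfl⟩ := hy
      dsimp only at hx hyy
      rw [gridPosition_childLocation _ _ _ hx, gridPosition, dif_neg hy'] at hyy
      have := hlt x b hx
      omega
    · obtain ⟨⟨x, b⟩, hx, rfl⟩ := hy'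
      dsimp only at hx hyy
      rw [gridPosition_childLocation _ _ _ hx, gridPosition, dif_neg hy] at hyy
      have := hlt x b hx
      omega
    · rw [gridPosition, dif_neg hy, gridPosition, dif_neg hy'] at hyy
      exact Encodable.encode_injective (by omega)

/-- Skyscraper grids exist for any admissible sequence of side lengths. -/
noncomputable def SkyscraperGrids.ofDims (a : Fin d → ℕ) (ha : ∀ i, 0 < a i) (h : ℕ → ℕ)
    (h0 : h 0 = 1) (hh : ∀ n, 2 * h n ≤ h (n + 1)) : SkyscraperGrids d where
  a := a
  a_pos := ha
  h := h
  h_zero := h0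
  h_succ := hh
  left n x := gridPosition a h n x / 2 ^ (d * n)
  left_zero := by simp [gridPosition]
  left_succ n x hx b := by
    have := gridPosition_childLocation a h n hx b
    unfold childLocation at this
    rw [this, finFunctionFinEquiv_apply, mul_add, mul_one, pow_add]
    push_cast
    field_simp
  disjoint n x hx y hy hxy := by
    have hne : gridPosition a h n x ≠ gridPosition a h n y :=
      fun he => hxy (gridPosition_injOn a h n hx hy he)
    simp only [Function.onFun, ← add_div, Set.Ico_disjoint_Ico]
    rcases lt_or_gt_of_ne hne with hlt | hlt
    · refine (min_le_left _ _).trans (le_max_of_le_right ?_)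
      gcongr
      exact_mod_cast hlt
    · refine (min_le_right _ _).trans (le_max_of_le_left ?_)
      gcongr
      exact_mod_cast hlt

end Digits

/-! ### Locations and partial translations under refinement of the grids -/

namespace SkyscraperGrids

variable {d : ℕ} (G : SkyscraperGrids d)

theorem childLocation_mem_locations {n : ℕ} {x : Fin d → ℤ} (hx : x ∈ G.locations n)
    (b : Fin d → Fin 2) : childLocation (gridDims G.a G.h n) x b ∈ G.locations (n + 1) :=
  childLocation_mem_box (two_mul_gridDims_le G.a_pos G.h_zero G.h_succ n) hx b

theorem left_childLocation {n : ℕ} {x : Fin d → ℤ} (hx : x ∈ G.locations n)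
    (b : Fin d → Fin 2) : G.left (n + 1) (childLocation (gridDims G.a G.h n) x b) =
      G.left n x + (finFunctionFinEquiv b : ℕ) * (1 / 2 ^ (d * (n + 1))) := by
  have := G.left_succ n x hx b
  rw [finFunctionFinEquiv_apply]
  push_cast
  exact this

theorem location_unique {n : ℕ} {x x' : Fin d → ℤ} {y : ℝ} (hx : x ∈ G.locations n)
    (hx' : x' ∈ G.locations n) (hy : y ∈ G.level n x) (hy' : y ∈ G.level n x') : x = x' :=
  (G.disjoint n).elim hx hx' (Set.not_disjoint_iff.2 ⟨y, hy, hy'⟩)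

theorem exists_mem_level_childLocation {n : ℕ} {x : Fin d → ℤ} {y : ℝ} (hx : x ∈ G.locations n)
    (hy : y ∈ G.level n x) :
    ∃ b, y ∈ G.level (n + 1) (childLocation (gridDims G.a G.h n) x b) := by
  have hpos : (0 : ℝ) < 2 ^ (d * (n + 1)) := by positivity
  have h0 : 0 ≤ (y - G.left n x) * 2 ^ (d * (n + 1)) :=
    mul_nonneg (sub_nonneg.2 hy.1) hpos.le
  have h1 : (y - G.left n x) * 2 ^ (d * (n + 1)) < 2 ^ d := by
    have := hy.2
    have h2 : y - G.left n x < 1 / 2 ^ (d * n) := by linarith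
    rw [lt_div_iff₀ (by positivity)] at h2
    rw [mul_add, mul_one, pow_add, ← mul_assoc]
    exact mul_lt_of_lt_one_left (by positivity) h2
  have hj : ⌊(y - G.left n x) * 2 ^ (d * (n + 1))⌋₊ < 2 ^ d := by
    rw [Nat.floor_lt h0]
    exact_mod_cast h1
  -- The number of the piece is the integer part of the offset of `y` in its level, in units of the
  -- new length.
  refine ⟨finFunctionFinEquiv.symm ⟨_, hj⟩, ?_⟩
  rw [level, G.left_childLocation hx, Equiv.apply_symm_apply]
  have h3 := Nat.floor_le h0
  have h4 := Nat.lt_floor_add_one ((y - G.left n x) * 2 ^ (d * (n + 1)))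
  constructor
  · rw [mul_one_div, ← le_sub_iff_add_le', div_le_iff₀ hpos]
    exact h3
  · rw [add_assoc, ← sub_lt_iff_lt_add', ← add_one_mul, mul_one_div, lt_div_iff₀ hpos]
    exact h4

/-- The point `y` lies in a level of the `n`-th grid, at location `x`. -/
def LocatedAt (n : ℕ) (y : ℝ) (x : Fin d → ℤ) : Prop :=
  x ∈ G.locations n ∧ y ∈ G.level n x

variable {G}

theorem LocatedAt.unique {n : ℕ} {y : ℝ} {x x' : Fin d → ℤ} (h : G.LocatedAt n y x)
    (h' : G.LocatedAt n y x') : x = x' :=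
  G.location_unique h.1 h'.1 h.2 h'.2

theorem LocatedAt.succ {n : ℕ} {y : ℝ} {x : Fin d → ℤ} (h : G.LocatedAt n y x) :
    ∃ b, G.LocatedAt (n + 1) y (childLocation (gridDims G.a G.h n) x b) :=
  (G.exists_mem_level_childLocation h.1 h.2).imp fun b hb =>
    ⟨G.childLocation_mem_locations h.1 b, hb⟩

theorem LocatedAt.exists_of_le {n m : ℕ} (hnm : n ≤ m) {y : ℝ} {x : Fin d → ℤ}
    (h : G.LocatedAt n y x) : ∃ x', G.LocatedAt m y x' := by
  induction m, hnm using Nat.le_induction with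
  | base => exact ⟨x, h⟩
  | succ m _ ih =>
    obtain ⟨x', h'⟩ := ih
    exact ⟨_, h'.succ.choose_spec⟩

variable (G)

/-- The translation by `v` in the `n`-th grid is defined at `y`, with value `z`. For a basis
vector `v` this is the grid map. -/
def Moves (n : ℕ) (v : Fin d → ℤ) (y z : ℝ) : Prop :=
  ∃ x ∈ G.locations n, x + v ∈ G.locations n ∧ y ∈ G.level n x ∧
    z = y - G.left n x + G.left n (x + v)

variable {G}

theorem Moves.mem_level {n : ℕ} {v : Fin d → ℤ} {y z : ℝ} {x : Fin d → ℤ}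
    (hy : y ∈ G.level n x) (hz : z = y - G.left n x + G.left n (x + v)) :
    z ∈ G.level n (x + v) := by
  have h1 := hy.1
  have h2 := hy.2
  constructor <;> linarith

theorem Moves.unique {n : ℕ} {v : Fin d → ℤ} {y z z' : ℝ} (h : G.Moves n v y z)
    (h' : G.Moves n v y z') : z = z' := by
  obtain ⟨x, hx, -, hy, rfl⟩ := h
  obtain ⟨x', hx', -, hy', rfl⟩ := h'
  rw [G.location_unique hx hx' hy hy']

theorem Moves.neg {n : ℕ} {v : Fin d → ℤ} {y z : ℝ} (h : G.Moves n v y z) :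
    G.Moves n (-v) z y := by
  obtain ⟨x, hx, hxv, hy, hz⟩ := h
  refine ⟨x + v, hxv, by rwa [add_neg_cancel_right], Moves.mem_level hy hz, ?_⟩
  rw [add_neg_cancel_right, hz]
  ring

theorem Moves.add {n : ℕ} {v w : Fin d → ℤ} {y z u : ℝ} (h : G.Moves n w y z)
    (h' : G.Moves n v z u) : G.Moves n (v + w) y u := by
  obtain ⟨x, hx, hxw, hy, hz⟩ := h
  obtain ⟨x', hx', hxv, hz', hu⟩ := h'
  obtain rfl := G.location_unique hxw hx' (Moves.mem_level hy hz) hz'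
  have e : x + (v + w) = x + w + v := by abel
  refine ⟨x, hx, by rwa [e], hy, ?_⟩
  rw [e, hu, hz]
  ring

/-- Pieces with the same digits have the same offset inside their parent levels and their locations
again differ by `v`. Later translations therefore extend earlier ones. -/
theorem Moves.succ {n : ℕ} {v : Fin d → ℤ} {y z : ℝ} (h : G.Moves n v y z) :
    G.Moves (n + 1) v y z := by
  obtain ⟨x, hx, hxv, hy, hz⟩ := h
  obtain ⟨b, hb⟩ := G.exists_mem_level_childLocation hx hy
  have e : childLocation (gridDims G.a G.h n) x b + v =
      childLocation (gridDims G.a G.h n) (x + v) b := by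
    funext k
    simp only [childLocation, Pi.add_apply]
    ring
  refine ⟨_, G.childLocation_mem_locations hx b, ?_, hb, ?_⟩
  · rw [e]
    exact G.childLocation_mem_locations hxv b
  · rw [e, G.left_childLocation hx, G.left_childLocation hxv, hz]
    ring

theorem Moves.mono {n m : ℕ} (hnm : n ≤ m) {v : Fin d → ℤ} {y z : ℝ} (h : G.Moves n v y z) :
    G.Moves m v y z := by
  induction m, hnm using Nat.le_induction with
  | base => exact h
  | succ m _ ih => exact ih.succ

theorem Moves.mem_space {n : ℕ} {v : Fin d → ℤ} {y z : ℝ} (h : G.Moves n v y z) :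
    z ∈ G.space := by
  obtain ⟨x, hx, hxv, hy, hz⟩ := h
  exact Set.mem_iUnion.2 ⟨n, Set.mem_biUnion hxv (Moves.mem_level hy hz)⟩

/-! ### Almost every point leaves the neighbourhood of the faces -/

variable (G)

theorem volume_level (n : ℕ) (x : Fin d → ℤ) :
    volume (G.level n x) = ((2 : ENNReal) ^ d)⁻¹ ^ n := by
  rw [level, Real.volume_Ico, add_sub_cancel_left, pow_mul, one_div,
    ENNReal.ofReal_inv_of_pos (by positivity), ENNReal.ofReal_pow (by positivity),
    ENNReal.ofReal_pow (by positivity), ENNReal.inv_pow]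
  simp

/-- Descendants in the grid `K + j` of the levels of the grid `K` none of whose last `j` binary
digits in direction `i` is different from `ε`. -/
noncomputable def constantDigitLocations (K : ℕ) (i : Fin d) (ε : Fin 2) : ℕ → Finset (Fin d → ℤ)
  | 0 => boxFinset (gridDims G.a G.h K)
  | j + 1 => Finset.image₂ (childLocation (gridDims G.a G.h (K + j)))
      (constantDigitLocations K i ε j) (Finset.univ.filter fun b => b i = ε)

theorem card_constantDigitLocations_le (K : ℕ) (i : Fin d) (ε : Fin 2) (j : ℕ) :
    (G.constantDigitLocations K i ε j).card ≤
      (boxFinset (gridDims G.a G.h K)).card * (2 ^ d - 1) ^ j := by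
  induction j with
  | zero => simp [constantDigitLocations]
  | succ j ih =>
    refine (Finset.card_image₂_le _ _ _).trans ?_
    rw [pow_succ, ← mul_assoc]
    refine Nat.mul_le_mul ih (Nat.le_sub_one_of_lt ?_)
    have : (Finset.univ.filter fun b : Fin d → Fin 2 => b i = ε).card <
        Fintype.card (Fin d → Fin 2) :=
      Finset.card_lt_univ_of_notMem (x := fun _ => ε + 1) (by
        have : ∀ ε : Fin 2, ε + 1 ≠ ε := by decide
        simp [this])
    simpa using this

theorem mem_constantDigitLocations {K : ℕ} {i : Fin d} {ε : Fin 2}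
    {Q : ℕ → (Fin d → ℤ) → Prop}
    (hQ : ∀ j, ∀ x ∈ G.locations (K + j), ∀ b,
      Q (j + 1) (childLocation (gridDims G.a G.h (K + j)) x b) → b i = ε ∧ Q j x)
    {y : ℝ} {x₀ : Fin d → ℤ} (hy : G.LocatedAt K y x₀) (j : ℕ) {x : Fin d → ℤ}
    (hx : G.LocatedAt (K + j) y x) (hQx : Q j x) : x ∈ G.constantDigitLocations K i ε j := by
  induction j generalizing x with
  | zero => exact mem_boxFinset.2 hx.1
  | succ j ih =>
    obtain ⟨x', hx'⟩ := hy.exists_of_le (Nat.le_add_right K j)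
    obtain ⟨b, hb⟩ := hx'.succ
    obtain rfl := hx.unique hb
    have h := hQ j x' hx'.1 b hQx
    exact Finset.mem_image₂_of_mem (ih hx' h.2) (by simpa using h.1)

/-- A condition `Q` that forces the digit in direction `i` at every step keeps at most `2 ^ d - 1`
of the `2 ^ d` children each time, so the measure decays geometrically. The true ratio is one half;
the crude one suffices. -/
theorem volume_constantDigit_le {K : ℕ} {i : Fin d} {ε : Fin 2}
    {Q : ℕ → (Fin d → ℤ) → Prop}
    (hQ : ∀ j, ∀ x ∈ G.locations (K + j), ∀ b,
      Q (j + 1) (childLocation (gridDims G.a G.h (K + j)) x b) → b i = ε ∧ Q j x) (j : ℕ) :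
    volume {y | (∃ x₀, G.LocatedAt K y x₀) ∧ ∃ x, G.LocatedAt (K + j) y x ∧ Q j x} ≤
      (boxFinset (gridDims G.a G.h K)).card *
        (((2 ^ d - 1 : ℕ) : ENNReal) * ((2 : ENNReal) ^ d)⁻¹) ^ j := by
  have hsub : {y | (∃ x₀, G.LocatedAt K y x₀) ∧ ∃ x, G.LocatedAt (K + j) y x ∧ Q j x} ⊆
      ⋃ x ∈ G.constantDigitLocations K i ε j, G.level (K + j) x := by
    rintro y ⟨⟨x₀, h0⟩, x, hx, hQx⟩
    exact Set.mem_biUnion (G.mem_constantDigitLocations hQ h0 j hx hQx) hx.2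
  refine (measure_mono hsub).trans ((measure_biUnion_finset_le _ _).trans ?_)
  simp only [volume_level, Finset.sum_const, nsmul_eq_mul]
  rw [mul_pow, ← mul_assoc]
  refine mul_le_mul' ?_ ?_
  · exact_mod_cast G.card_constantDigitLocations_le K i ε j
  · refine pow_le_pow_right_of_le_one' ?_ (Nat.le_add_left j K)
    exact ENNReal.inv_le_one.2 (one_le_pow₀ (by norm_num))

open Topology in
theorem tendsto_volume_constantDigit (K : ℕ) :
    Tendsto (fun j : ℕ => ((boxFinset (gridDims G.a G.h K)).card : ENNReal) *
        (((2 ^ d - 1 : ℕ) : ENNReal) * ((2 : ENNReal) ^ d)⁻¹) ^ j) atTop (𝓝 0) := by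
  have hlt : ((2 ^ d - 1 : ℕ) : ENNReal) * ((2 : ENNReal) ^ d)⁻¹ < 1 := by
    rw [← div_eq_mul_inv]
    refine ENNReal.div_lt_of_lt_mul' ?_
    rw [mul_one]
    exact_mod_cast Nat.sub_lt (pow_pos two_pos d) one_pos
  have := ENNReal.Tendsto.const_mul (ENNReal.tendsto_pow_atTop_nhds_zero_of_lt_one hlt)
    (Or.inr (ENNReal.natCast_ne_top (boxFinset (gridDims G.a G.h K)).card))
  rwa [mul_zero] at this

theorem two_pow_le_gridDims (n : ℕ) (i : Fin d) : 2 ^ n ≤ gridDims G.a G.h n i := by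
  induction n with
  | zero => exact le_rfl
  | succ n ih =>
    have := two_mul_gridDims_le G.a_pos G.h_zero G.h_succ n i
    rw [pow_succ]
    omega

/-- Translation by `v` is eventually defined at almost every point present in the grid `K`. -/
theorem volume_forall_not_moves (K : ℕ) {v : Fin d → ℤ} (hv : ∀ i, |v i| ≤ 2 ^ K) :
    volume {y | (∃ x₀, G.LocatedAt K y x₀) ∧ ∀ n z, ¬ G.Moves n v y z} = 0 := by
  -- Sides of these grids are at least `2 ^ K`, so a child with digit 1 is not within `2 ^ K` of the
  -- lower face. A child with digit 0 is not within `2 ^ K` of the upper one, since sides at least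
  -- double. Staying near a face thus forces constant digits.
  have hlow : ∀ i : Fin d, ∀ j, ∀ x ∈ G.locations (K + j), ∀ b : Fin d → Fin 2,
      childLocation (gridDims G.a G.h (K + j)) x b i < 2 ^ K → b i = 0 ∧ x i < 2 ^ K := by
    intro i j x hx b h
    have h1 : (2 ^ K : ℤ) ≤ gridDims G.a G.h (K + j) i := by
      exact_mod_cast (Nat.pow_le_pow_right two_pos (Nat.le_add_right K j)).trans
        (G.two_pow_le_gridDims (K + j) i)
    have h2 := hx i
    simp only [childLocation] at h
    rcases fin_two_val_eq (b i) with ⟨e1, e2⟩ | ⟨e1, e2⟩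
    · rw [e2] at h
      exact ⟨e1, by omega⟩
    · rw [e2] at h
      omega
  have hhigh : ∀ i : Fin d, ∀ j, ∀ x ∈ G.locations (K + j), ∀ b : Fin d → Fin 2,
      (gridDims G.a G.h (K + (j + 1)) i : ℤ) - 2 ^ K ≤
        childLocation (gridDims G.a G.h (K + j)) x b i →
      b i = 1 ∧ (gridDims G.a G.h (K + j) i : ℤ) - 2 ^ K ≤ x i := by
    intro i j x hx b h
    have h1 : (2 ^ K : ℤ) ≤ gridDims G.a G.h (K + j) i := by
      exact_mod_cast (Nat.pow_le_pow_right two_pos (Nat.le_add_right K j)).trans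
        (G.two_pow_le_gridDims (K + j) i)
    have h2 := hx i
    have h3 : (2 * gridDims G.a G.h (K + j) i : ℤ) ≤ gridDims G.a G.h (K + (j + 1)) i := by
      exact_mod_cast two_mul_gridDims_le G.a_pos G.h_zero G.h_succ (K + j) i
    simp only [childLocation] at h
    rcases fin_two_val_eq (b i) with ⟨e1, e2⟩ | ⟨e1, e2⟩
    · rw [e2] at h
      omega
    · rw [e2] at h
      exact ⟨e1, by omega⟩
  let C : ℕ → ENNReal := fun j => (boxFinset (gridDims G.a G.h K)).card *
        (((2 ^ d - 1 : ℕ) : ENNReal) * ((2 : ENNReal) ^ d)⁻¹) ^ j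
  have hbound : ∀ j, volume {y | (∃ x₀, G.LocatedAt K y x₀) ∧ ∀ n z, ¬ G.Moves n v y z} ≤
      ∑ _i : Fin d, (C j + C j) := by
    intro j
    have hsub : {y | (∃ x₀, G.LocatedAt K y x₀) ∧ ∀ n z, ¬ G.Moves n v y z} ⊆
        ⋃ i ∈ (Finset.univ : Finset (Fin d)),
          ({y | (∃ x₀, G.LocatedAt K y x₀) ∧ ∃ x, G.LocatedAt (K + j) y x ∧ x i < 2 ^ K} ∪
          {y | (∃ x₀, G.LocatedAt K y x₀) ∧ ∃ x, G.LocatedAt (K + j) y x ∧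
            (gridDims G.a G.h (K + j) i : ℤ) - 2 ^ K ≤ x i}) := by
      rintro y ⟨⟨x₀, h0⟩, hy⟩
      obtain ⟨x, hx⟩ := h0.exists_of_le (Nat.le_add_right K j)
      -- If the translate leaves the box, some coordinate of `x` is within `2 ^ K` of a face.
      have hout : x + v ∉ G.locations (K + j) := fun hin => hy (K + j) _ ⟨x, hx.1, hin, hx.2, rfl⟩
      simp only [locations, box, Set.mem_ofPred_eq, not_forall] at hout
      obtain ⟨i, hi⟩ := hout
      refine Set.mem_biUnion (Finset.mem_univ i) ?_
      have hvi := abs_le.1 (hv i)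
      rw [Pi.add_apply] at hi
      by_cases hc : x i < 2 ^ K
      · exact Or.inl ⟨⟨x₀, h0⟩, x, hx, hc⟩
      · exact Or.inr ⟨⟨x₀, h0⟩, x, hx, by omega⟩
    refine (measure_mono hsub).trans ((measure_biUnion_finset_le _ _).trans ?_)
    refine Finset.sum_le_sum fun i _ => (measure_union_le _ _).trans (add_le_add ?_ ?_)
    · exact G.volume_constantDigit_le (i := i) (ε := 0) (Q := fun _ x => x i < 2 ^ K) (hlow i) j
    · exact G.volume_constantDigit_le (i := i) (ε := 1)
        (Q := fun j x => (gridDims G.a G.h (K + j) i : ℤ) - 2 ^ K ≤ x i) (hhigh i) j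
  have hC := G.tendsto_volume_constantDigit K
  have hlim : Tendsto (fun j => ∑ _i : Fin d, (C j + C j)) atTop
      (nhds (∑ _i : Fin d, ((0 : ENNReal) + 0))) :=
    tendsto_finsetSum _ fun _ _ => hC.add hC
  simp only [add_zero, Finset.sum_const_zero] at hlim
  exact le_antisymm (ge_of_tendsto' hlim hbound) zero_le

end SkyscraperGrids

/-- An invertible transformation that preserves the measure of the measurable subsets of each
member of a countable cover preserves the measure. -/
theorem MeasurableEquiv.measurePreserving_of_iUnion_eq_univ {α ι : Type*} [MeasurableSpace α]
    [Countable ι] {ν : Measure α} (e : α ≃ᵐ α) {E : ι → Set α} (hE : ∀ i, MeasurableSet (E i))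
    (hcover : ⋃ i, E i = _root_.Set.univ)
    (h : ∀ i, ∀ C ⊆ E i, MeasurableSet C → ν (e ⁻¹' C) = ν C) : MeasurePreserving e ν ν := by
  refine ⟨e.measurable, (Measure.ext_iff_of_iUnion_eq_univ hcover).2 fun i => ?_⟩
  ext C hC
  rw [Measure.restrict_apply hC, Measure.restrict_apply hC, e.map_apply]
  exact h i _ Set.inter_subset_right (hC.inter (hE i))

/-! ### The limiting translations as a measure-preserving action -/

namespace SkyscraperGrids

variable {d : ℕ} {G : SkyscraperGrids d}

theorem Moves.unique' {n m : ℕ} {v : Fin d → ℤ} {y z z' : ℝ} (h : G.Moves n v y z)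
    (h' : G.Moves m v y z') : z = z' :=
  (h.mono (le_max_left n m)).unique (h'.mono (le_max_right n m))

variable (G)

/-- All translations are eventually defined at `y`. -/
def Good (y : ℝ) : Prop :=
  ∀ v, ∃ n z, G.Moves n v y z

variable {G}

/-- Undo the move by `v`, then move `y` by `w + v`. So the good points form an invariant set. -/
theorem Good.of_moves {n : ℕ} {v : Fin d → ℤ} {y z : ℝ} (hy : G.Good y) (h : G.Moves n v y z) :
    G.Good z := by
  intro w
  obtain ⟨m, u, hu⟩ := hy (w + v)
  refine ⟨max n m, u, ?_⟩
  have := (h.neg.mono (le_max_left n m)).add (hu.mono (le_max_right n m))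
  rwa [add_neg_cancel_right] at this

theorem mem_space_iff {y : ℝ} : y ∈ G.space ↔ ∃ n x, G.LocatedAt n y x := by
  simp [space, LocatedAt]

variable (G)

open Classical in
/-- The limit of the translations by `v`, extended by the identity. -/
noncomputable def translate (v : Fin d → ℤ) (y : G.space) : G.space :=
  if hy : G.Good y then ⟨(hy v).choose_spec.choose, (hy v).choose_spec.choose_spec.mem_space⟩
  else y

variable {G}

theorem exists_moves_translate (v : Fin d → ℤ) {y : G.space} (hy : G.Good y) :
    ∃ n, G.Moves n v y (G.translate v y) := by
  rw [translate, dif_pos hy]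
  exact ⟨_, (hy v).choose_spec.choose_spec⟩

theorem translate_of_not_good (v : Fin d → ℤ) {y : G.space} (hy : ¬ G.Good y) :
    G.translate v y = y := by
  rw [translate, dif_neg hy]

theorem Moves.translate_eq {n : ℕ} {v : Fin d → ℤ} {y z : G.space} (h : G.Moves n v y z)
    (hy : G.Good y) : G.translate v y = z :=
  Subtype.ext ((exists_moves_translate v hy).choose_spec.unique' h)

theorem good_translate {v : Fin d → ℤ} {y : G.space} (hy : G.Good y) :
    G.Good (G.translate v y) :=
  hy.of_moves (exists_moves_translate v hy).choose_spec

variable (G)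

theorem translate_zero (y : G.space) : G.translate 0 y = y := by
  by_cases hy : G.Good y
  · obtain ⟨n, z, x, hx, hx0, hyx, hz⟩ := hy 0
    refine Moves.translate_eq (n := n) ⟨x, hx, hx0, hyx, ?_⟩ hy
    rw [add_zero]
    ring
  · exact translate_of_not_good 0 hy

/-- The law holds at every point: good points stay good, and all the others are fixed. -/
theorem translate_add (v w : Fin d → ℤ) (y : G.space) :
    G.translate (v + w) y = G.translate v (G.translate w y) := by
  by_cases hy : G.Good y
  · obtain ⟨n, hn⟩ := exists_moves_translate w hy
    obtain ⟨m, hm⟩ := exists_moves_translate v (good_translate (v := w) hy)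
    exact Moves.translate_eq ((hn.mono (le_max_left n m)).add (hm.mono (le_max_right n m))) hy
  · rw [translate_of_not_good w hy, translate_of_not_good v hy, translate_of_not_good _ hy]

theorem measurableSet_locatedAt (n : ℕ) (x : Fin d → ℤ) :
    MeasurableSet {y : G.space | G.LocatedAt n y x} := by
  by_cases hx : x ∈ G.locations n
  · have : {y : G.space | G.LocatedAt n y x} = (↑) ⁻¹' G.level n x := by
      ext y
      exact and_iff_right hx
    rw [this]
    exact measurable_subtype_coe measurableSet_Ico
  · have : {y : G.space | G.LocatedAt n y x} = ∅ :=
      Set.eq_empty_of_forall_notMem fun y hy => hx hy.1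
    rw [this]
    exact MeasurableSet.empty

theorem measurableSet_locatedAt_and (n : ℕ) (x : Fin d → ℤ) (p : Prop) :
    MeasurableSet {y : G.space | G.LocatedAt n y x ∧ p} :=
  (G.measurableSet_locatedAt n x).inter (MeasurableSet.const p)

theorem measurableSet_good : MeasurableSet {y : G.space | G.Good y} := by
  have : {y : G.space | G.Good y} =
      ⋂ v : Fin d → ℤ, ⋃ n, ⋃ x, {y : G.space | G.LocatedAt n y x ∧ x + v ∈ G.locations n} := by
    ext y
    simp only [Set.mem_ofPred_eq, Set.mem_iInter, Set.mem_iUnion]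
    refine forall_congr' fun v => exists_congr fun n => ?_
    constructor
    · rintro ⟨z, x, hx, hxv, hy, -⟩
      exact ⟨x, ⟨hx, hy⟩, hxv⟩
    · rintro ⟨x, ⟨hx, hy⟩, hxv⟩
      exact ⟨_, x, hx, hxv, hy, rfl⟩
  rw [this]
  exact MeasurableSet.iInter fun v => MeasurableSet.iUnion fun n => MeasurableSet.iUnion fun x =>
    G.measurableSet_locatedAt_and n x _

theorem measurable_translate (v : Fin d → ℤ) : Measurable (G.translate v) := by
  have hcoe : Measurable fun y : G.space => (G.translate v y : ℝ) := by
    intro t ht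
    have : (fun y : G.space => (G.translate v y : ℝ)) ⁻¹' t =
        ({y : G.space | G.Good y}ᶜ ∩ (↑) ⁻¹' t) ∪ ({y : G.space | G.Good y} ∩
          ⋃ n, ⋃ x, ({y : G.space | G.LocatedAt n y x ∧ x + v ∈ G.locations n} ∩
            (fun y : G.space => (y : ℝ) - G.left n x + G.left n (x + v)) ⁻¹' t)) := by
      ext y
      by_cases hy : G.Good y
      · simp only [Set.mem_preimage, Set.mem_union, Set.mem_inter_iff, Set.mem_compl_iff,
          Set.mem_ofPred_eq, hy, not_true_eq_false, false_and, false_or, true_and,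
          Set.mem_iUnion]
        constructor
        · intro h
          obtain ⟨n, x, hx, hxv, hyx, he⟩ := exists_moves_translate v hy
          exact ⟨n, x, ⟨⟨hx, hyx⟩, hxv⟩, he ▸ h⟩
        · rintro ⟨n, x, ⟨⟨hx, hyx⟩, hxv⟩, h⟩
          have := (exists_moves_translate v hy).choose_spec.unique'
            (⟨x, hx, hxv, hyx, rfl⟩ : G.Moves n v y _)
          rwa [this]
      · simp [hy, translate_of_not_good v hy]
    rw [this]
    refine (G.measurableSet_good.compl.inter (measurable_subtype_coe ht)).union
      (G.measurableSet_good.inter (MeasurableSet.iUnion fun n => MeasurableSet.iUnion fun x =>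
        (G.measurableSet_locatedAt_and n x _).inter ?_))
    exact ((measurable_subtype_coe.sub_const _).add_const _) ht
  exact hcoe.subtype_mk

/-- The limit of the translations by `v` as an invertible transformation. -/
noncomputable def translateEquiv (v : Fin d → ℤ) : G.space ≃ᵐ G.space where
  toFun := G.translate v
  invFun := G.translate (-v)
  left_inv y := by rw [← translate_add, neg_add_cancel, translate_zero]
  right_inv y := by rw [← translate_add, add_neg_cancel, translate_zero]
  measurable_toFun := G.measurable_translate v
  measurable_invFun := G.measurable_translate (-v)

theorem measure_apply {C : Set G.space} : G.measure C = volume ((↑) '' C : Set ℝ) :=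
  comap_subtype_coe_apply G.measurableSet_space volume C

/-- Good points are covered by countably many pieces, given by a grid and a location, on which the
inverse map is a single translation of `ℝ`; Lebesgue measure is translation invariant. The pieces
describe target points, hence the sign in `-v`. -/
theorem measurePreserving_translateEquiv (v : Fin d → ℤ) :
    MeasurePreserving (G.translateEquiv v) G.measure G.measure := by
  have happ : ∀ y, G.translateEquiv v y = G.translate v y := fun _ => rfl
  refine (G.translateEquiv v).measurePreserving_of_iUnion_eq_univ
    (E := fun o : Option (ℕ × (Fin d → ℤ)) => o.elim {y : G.space | ¬ G.Good y} fun q =>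
      {y : G.space | G.Good y} ∩
        {y : G.space | G.LocatedAt q.1 y q.2 ∧ q.2 + -v ∈ G.locations q.1}) ?_ ?_ ?_
  · rintro (_ | q)
    · exact G.measurableSet_good.compl
    · exact G.measurableSet_good.inter (G.measurableSet_locatedAt_and _ _ _)
  · refine Set.eq_univ_of_forall fun y => Set.mem_iUnion.2 ?_
    by_cases hy : G.Good y
    · obtain ⟨n, z, x, hx, hxv, hyx, -⟩ := hy (-v)
      exact ⟨some (n, x), hy, ⟨hx, hyx⟩, hxv⟩
    · exact ⟨none, hy⟩
  · rintro (_ | ⟨n, x⟩) C hC -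
    · congr 1
      ext y
      rw [Set.mem_preimage, happ]
      by_cases hy : G.Good y
      · exact ⟨fun h => absurd (good_translate hy) (hC h), fun h => absurd hy (hC h)⟩
      · rw [translate_of_not_good v hy]
    · rw [measure_apply, measure_apply]
      have : ((↑) '' (G.translateEquiv v ⁻¹' C) : Set ℝ) =
          (fun y => y + (G.left n x - G.left n (x + -v))) ⁻¹' ((↑) '' C) := by
        ext y
        constructor
        · rintro ⟨y, hy, rfl⟩
          refine ⟨_, hy, ?_⟩
          rw [happ]
          obtain ⟨hgood, ⟨hx, hyx⟩, hxv⟩ := hC hy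
          rw [happ] at hgood hyx
          have h1 : G.translate (-v) (G.translate v y) = y := (G.translateEquiv v).left_inv y
          obtain ⟨m, hm⟩ := exists_moves_translate (-v) hgood
          rw [h1] at hm
          rw [hm.unique' (⟨x, hx, hxv, hyx, rfl⟩ : G.Moves n (-v) (G.translate v y) _)]
          ring
        · rintro ⟨z, hz, hzy⟩
          obtain ⟨hgood, ⟨hx, hzx⟩, hxv⟩ := hC hz
          have hm : G.Moves n (-v) z y := ⟨x, hx, hxv, hzx, by rw [hzy]; ring⟩
          refine ⟨⟨y, hm.mem_space⟩, ?_, rfl⟩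
          rw [Set.mem_preimage, happ,
            ← Moves.translate_eq (z := ⟨y, hm.mem_space⟩) hm hgood, ← translate_add,
            add_neg_cancel, translate_zero]
          exact hz
      rw [this, measure_preimage_add_right]

/-- The skyscraper action given by grids. -/
noncomputable def action : MPAction d G.measure where
  map := G.translateEquiv
  measurePreserving := G.measurePreserving_translateEquiv
  map_zero := Eventually.of_forall G.translate_zero
  map_add v w := Eventually.of_forall (G.translate_add v w)

theorem ae_good : ∀ᵐ y : G.space ∂G.measure, G.Good y := by
  refine ae_all_iff.2 fun v => ?_
  obtain ⟨K₀, hK₀⟩ : ∃ K₀ : ℕ, ∀ i, |v i| ≤ 2 ^ K₀ := by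
    refine ⟨∑ i, (v i).natAbs, fun i => ?_⟩
    have h1 : (v i).natAbs ≤ ∑ i, (v i).natAbs :=
      Finset.single_le_sum (f := fun i => (v i).natAbs) (fun _ _ => Nat.zero_le _)
        (Finset.mem_univ i)
    rw [Int.abs_eq_natAbs]
    exact_mod_cast h1.trans Nat.lt_two_pow_self.le
  rw [ae_iff, measure_apply]
  -- A point present in the grid `n` is also present in the grid `n + K₀`, which is late enough for
  -- the bound on `v`.
  refine measure_mono_null (t := ⋃ n, {y | (∃ x₀, G.LocatedAt (n + K₀) y x₀) ∧
    ∀ n z, ¬ G.Moves n v y z}) ?_ (measure_iUnion_null fun n => G.volume_forall_not_moves _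
      fun i => (hK₀ i).trans (pow_le_pow_right₀ one_le_two (Nat.le_add_left _ _)))
  rintro _ ⟨y, hy, rfl⟩
  obtain ⟨n, x, hx⟩ := mem_space_iff.1 y.2
  simp only [Set.mem_ofPred_eq, not_exists] at hy
  exact Set.mem_iUnion.2 ⟨n, hx.exists_of_le (Nat.le_add_right n K₀), hy⟩

theorem isSkyscraperAction_action : G.IsSkyscraperAction G.action := by
  intro i
  filter_upwards [G.ae_good] with y hy
  obtain ⟨n, hn⟩ := exists_moves_translate (Pi.single i 1) hy
  exact eventually_atTop.2 ⟨n, fun m hm => hn.mono hm⟩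

end SkyscraperGrids

/-- The nonzero square vectors, as a finite set. -/
noncomputable def squareVectorFinset {d : ℕ} (a : Fin d → ℕ) : Finset (Fin d → ℤ) :=
  ((Fintype.piFinset fun _ : Fin d => ({-1, 0, 1} : Finset ℤ)).image
    fun c i => c i * (a i : ℤ)).erase 0

theorem mem_squareVectorFinset {d : ℕ} {a : Fin d → ℕ} {p : Fin d → ℤ} :
    p ∈ squareVectorFinset a ↔ p ∈ squareVectors a ∧ p ≠ 0 := by
  simp only [squareVectorFinset, Finset.mem_erase, Finset.mem_image, Fintype.mem_piFinset,
    Finset.mem_insert, Finset.mem_singleton, squareVectors, Set.mem_ofPred_eq, and_comm]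
  refine and_congr_right fun _ => exists_congr fun c => and_congr_left fun _ => ?_
  simp only [funext_iff, eq_comm]

/-- The vectors with `|wᵢ| ≤ 2 aᵢ k`. -/
noncomputable def centeredBox {d : ℕ} (a : Fin d → ℕ) (k : ℕ) : Finset (Fin d → ℤ) :=
  Fintype.piFinset fun i => Finset.Icc (-(2 * a i * k : ℤ)) (2 * a i * k)

/-! ### Returns to the base level -/

namespace SkyscraperGrids

variable {d : ℕ} (G : SkyscraperGrids d)

theorem zero_mem_locations (n : ℕ) : (0 : Fin d → ℤ) ∈ G.locations n := fun i =>
  ⟨le_rfl, Int.natCast_pos.2 (gridDims_pos G.a_pos G.h_zero G.h_succ n i)⟩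

variable {G}

/-- The location is that of a child of a level of the grid `m`, whose sides are `aᵢ h m`. For `m =
0` the side formula fails, but the location is the origin. -/
theorem LocatedAt.mem_Icc {m : ℕ} {y : ℝ} {x : Fin d → ℤ} (hy : y ∈ G.level 1 0)
    (hx : G.LocatedAt (m + 1) y x) (i : Fin d) : x i ∈ Set.Icc (0 : ℤ) (2 * G.a i * G.h m) := by
  have h1 : G.LocatedAt 1 y 0 := ⟨G.zero_mem_locations 1, hy⟩
  cases m with
  | zero =>
    obtain rfl := hx.unique h1
    exact ⟨le_rfl, by positivity⟩
  | succ m =>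
    obtain ⟨x', hx'⟩ := h1.exists_of_le (Nat.le_add_left 1 m)
    obtain ⟨b, hb⟩ := hx'.succ
    obtain rfl := hx.unique hb
    have h2 := hx'.1 i
    simp only [gridDims, Nat.cast_mul] at h2
    simp only [childLocation, gridDims, Nat.cast_mul, Set.mem_Icc, mul_assoc]
    rcases fin_two_val_eq (b i) with ⟨-, e⟩ | ⟨-, e⟩ <;> rw [e] <;> constructor <;> linarith

/-- The translations returning a point of the first level of the grid `1` to that level. -/
theorem exists_eq_add_nsmul_of_moves {y z : ℝ} (hy : y ∈ G.level 1 0) (hz : z ∈ G.level 1 0)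
    {n : ℕ} {v : Fin d → ℤ} (h : G.Moves n v y z) (hv : v ≠ 0) :
    ∃ m, ∃ p ∈ squareVectorFinset G.a, ∃ w ∈ centeredBox G.a (G.h m),
      v = w + G.h (m + 1) • p := by
  classical
  have hy1 : G.LocatedAt 1 y 0 := ⟨G.zero_mem_locations 1, hy⟩
  have hz1 : G.LocatedAt 1 z 0 := ⟨G.zero_mem_locations 1, hz⟩
  -- Only grids from the first on are considered, because the sides of the grid 0 are not of the
  -- form `aᵢ h₀`. The least such `j` is used.
  have hex : ∃ j, ∃ x x', G.LocatedAt (j + 1) y x ∧ G.LocatedAt (j + 1) z x' ∧ x' = x + v := by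
    obtain ⟨x, hx, hxv, hyx, hzx⟩ := h.mono (Nat.le_add_right n 1)
    exact ⟨n, x, x + v, ⟨hx, hyx⟩, ⟨hxv, Moves.mem_level hyx hzx⟩, rfl⟩
  obtain ⟨x, x', hx, hx', he⟩ := Nat.find_spec hex
  have hmin := fun j => Nat.find_min hex (m := j)
  generalize Nat.find hex = j at hx hx' hmin
  cases j with
  | zero =>
    obtain rfl := hx.unique hy1
    obtain rfl := hx'.unique hz1
    exact absurd (by simpa using he.symm) hv
  | succ m =>
    obtain ⟨q, hq⟩ := hy1.exists_of_le (Nat.le_add_left 1 m)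
    obtain ⟨q', hq'⟩ := hz1.exists_of_le (Nat.le_add_left 1 m)
    obtain ⟨b, hb⟩ := hq.succ
    obtain ⟨b', hb'⟩ := hq'.succ
    obtain rfl := hx.unique hb
    obtain rfl := hx'.unique hb'
    -- The square vector is made of the differences of the last digits, and `q' - q` is the
    -- displacement in the preceding grid.
    have hve : v = (q' - q) + G.h (m + 1) •
        fun i => ((b' i : ℕ) - (b i : ℕ) : ℤ) * (G.a i : ℤ) := by
      funext i
      have := congrFun he i
      simp only [childLocation, gridDims, Pi.add_apply, Nat.cast_mul] at this
      simp only [Pi.add_apply, Pi.sub_apply, Pi.smul_apply]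
      rw [nsmul_eq_mul]
      linear_combination -this
    refine ⟨m, _, mem_squareVectorFinset.2 ⟨⟨_, fun i => ?_, fun i => rfl⟩, ?_⟩, q' - q, ?_, hve⟩
    · rcases fin_two_val_eq (b i) with ⟨-, e⟩ | ⟨-, e⟩ <;>
        rcases fin_two_val_eq (b' i) with ⟨-, e'⟩ | ⟨-, e'⟩ <;> rw [e, e'] <;> simp
    -- With equal last digits, the displacement would be `v` already in the preceding grid, against
    -- minimality.
    · intro h0
      rw [h0, smul_zero, add_zero] at hve
      exact hmin m (Nat.lt_succ_self m) ⟨q, q', hq, hq', by rw [hve]; abel⟩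
    · refine Fintype.mem_piFinset.2 fun i => Finset.mem_Icc.2 ?_
      have h1 := hq.mem_Icc hy i
      have h2 := hq'.mem_Icc hz i
      rw [Set.mem_Icc] at h1 h2
      rw [Pi.sub_apply]
      constructor <;> linarith

end SkyscraperGrids

/-! ### Choice of heights and the wandering set -/

namespace MPAction

variable {d : ℕ} {X : Type*} [MeasurableSpace X] {μ : Measure X}

/-- The sequence of heights can be chosen so that the square vectors scaled by the heights almost
fail to return a given set to itself. -/
theorem exists_heights (T : MPAction d μ) (hμ : μ Set.univ = ⊤) {a : Fin d → ℕ}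
    (hT : T.SquarelyErgodicWrt a) {A : Set X} (hA : MeasurableSet A) (hAμ : μ A ≠ ⊤)
    {δ : ℕ → ENNReal} (hδ : ∀ n, 0 < δ n) :
    ∃ h : ℕ → ℕ, h 0 = 1 ∧ (∀ n, 2 * h n ≤ h (n + 1)) ∧
      ∀ n, ∑ p ∈ squareVectorFinset a, ∑ w ∈ centeredBox a (h n),
        T.returnMeasure A (w + h (n + 1) • p) < δ n := by
  -- The finite set of offsets depends on the current height `k` alone, so it is fixed before the
  -- next height is chosen.
  have step : ∀ n k, ∃ k', 2 * k ≤ k' ∧ ∑ p ∈ squareVectorFinset a, ∑ w ∈ centeredBox a k,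
      T.returnMeasure A (w + k' • p) < δ n := fun n k =>
    T.exists_sum_returnMeasure_lt hμ hT hA hAμ _ _ (fun p hp => mem_squareVectorFinset.1 hp)
      (hδ n) (2 * k)
  choose next hnext using step
  obtain ⟨h, h0, hsucc⟩ : ∃ h : ℕ → ℕ, h 0 = 1 ∧ ∀ n, h (n + 1) = next n (h n) :=
    ⟨fun n => Nat.rec 1 next n, rfl, fun _ => rfl⟩
  refine ⟨h, h0, fun n => ?_, fun n => ?_⟩
  · rw [hsucc]
    exact (hnext n (h n)).1
  · rw [hsucc]
    exact (hnext n (h n)).2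

/-- If the returns of a set to itself have total measure less than the measure of the set, then
the action is not conservative. -/
theorem not_conservative_of_tsum_lt (T : MPAction d μ) {B : Set X} (hB : MeasurableSet B)
    (h : ∑' v : {v : Fin d → ℤ // v ≠ 0}, T.returnMeasure B v < μ B) : ¬ T.Conservative := by
  intro hcons
  have hmeas : ∀ v : {v : Fin d → ℤ // v ≠ 0}, MeasurableSet (B ∩ T.map v ⁻¹' B) := fun v =>
    hB.inter ((T.map v).measurable hB)
  -- The points of `B` that no nonzero vector returns to `B`; subadditivity leaves them positive
  -- measure.
  let W : Set X := B \ ⋃ v : {v : Fin d → ℤ // v ≠ 0}, B ∩ T.map v ⁻¹' B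
  have hW : MeasurableSet W := hB.diff (MeasurableSet.iUnion hmeas)
  have hpos : 0 < μ W := by
    refine (tsub_pos_of_lt ?_).trans_le le_measure_sdiff
    exact (measure_iUnion_le _).trans_lt h
  obtain ⟨v, hv, hvW⟩ := hcons W hW hpos
  have : T.map v '' W ∩ W = ∅ := by
    refine Set.eq_empty_of_forall_notMem ?_
    rintro _ ⟨⟨x, hx, rfl⟩, hx'⟩
    exact hx.2 (Set.mem_iUnion.2 ⟨⟨v, hv⟩, hx.1, hx'.1⟩)
  simp [this] at hvW

theorem prod_returnMeasure {Y : Type*} [MeasurableSpace Y] {ν : Measure Y} [SFinite μ] [SFinite ν]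
    (T : MPAction d μ) (S : MPAction d ν) (A : Set X) (I : Set Y) (v : Fin d → ℤ) :
    (T.prod S).returnMeasure (A ×ˢ I) v = T.returnMeasure A v * S.returnMeasure I v := by
  rw [returnMeasure, returnMeasure, returnMeasure, ← Measure.prod_prod]
  congr 1
  ext z
  change (z.1 ∈ A ∧ z.2 ∈ I) ∧ (T.map v z.1 ∈ A ∧ S.map v z.2 ∈ I) ↔
    (z.1 ∈ A ∧ T.map v z.1 ∈ A) ∧ (z.2 ∈ I ∧ S.map v z.2 ∈ I)
  tauto

end MPAction

theorem mainTheorem3 {d : ℕ} (hd : 1 ≤ d) {X : Type*} [MeasurableSpace X]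
    (μ : Measure X) [SigmaFinite μ] (hμ : μ Set.univ = ⊤)
    (T : MPAction d μ) (hT : T.SquarelyErgodic) :
    ∃ (G : SkyscraperGrids d) (S : MPAction d G.measure),
      G.IsSkyscraperAction S ∧ ¬ (T.prod S).Conservative := by
  obtain ⟨a, ha, hTa⟩ := hT
  obtain ⟨A, hA, hA0, hAμ⟩ : ∃ A, MeasurableSet A ∧ 0 < μ A ∧ μ A < ⊤ := by
    obtain ⟨A, hA, -, h0, h1⟩ := Measure.exists_subset_measure_lt_top (r := 0)
      MeasurableSet.univ (by rw [hμ]; exact ENNReal.zero_lt_top)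
    exact ⟨A, hA, h0, h1⟩
  obtain ⟨δ, hδ, hδA⟩ := ENNReal.exists_pos_sum_of_countable' hA0.ne' ℕ
  obtain ⟨h, h0, hh, hlt⟩ := T.exists_heights hμ hTa hA hAμ.ne hδ
  let G := SkyscraperGrids.ofDims a ha h h0 hh
  refine ⟨G, G.action, G.isSkyscraperAction_action, ?_⟩
  let I : Set G.space := {y | G.LocatedAt 1 y 0}
  have hI : MeasurableSet I := G.measurableSet_locatedAt 1 0
  have hImeas : G.measure I = ((2 : ENNReal) ^ d)⁻¹ := by
    have : ((↑) '' I : Set ℝ) = G.level 1 0 := by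
      ext y
      constructor
      · rintro ⟨y, hy, rfl⟩
        exact hy.2
      · intro hy
        have hloc : G.LocatedAt 1 y 0 := ⟨G.zero_mem_locations 1, hy⟩
        exact ⟨⟨y, SkyscraperGrids.mem_space_iff.2 ⟨1, 0, hloc⟩⟩, hloc, rfl⟩
    rw [G.measure_apply, this, G.volume_level, pow_one]
  have hIpos : G.measure I ≠ 0 := by simp [hImeas]
  have hItop : G.measure I ≠ ⊤ := by simp [hImeas]
  refine (T.prod G.action).not_conservative_of_tsum_lt (hA.prod hI) ?_
  simp only [MPAction.prod_returnMeasure, Measure.prod_prod]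
  let q : ℕ → (Fin d → ℤ) → (Fin d → ℤ) → (Fin d → ℤ) := fun n p w => w + h (n + 1) • p
  -- If `v` returns part of `I` to `I` with positive measure, a good point witnesses it, and `v`
  -- equals some `q m p w`. One such representation suffices for the bound.
  have hterm : ∀ v : {v : Fin d → ℤ // v ≠ 0},
      T.returnMeasure A v * G.action.returnMeasure I v ≤
      ∑' n, ∑ p ∈ squareVectorFinset a, ∑ w ∈ centeredBox a (h n),
        if q n p w = v then T.returnMeasure A v * G.measure I else 0 := by
    intro v
    by_cases hz : G.action.returnMeasure I v = 0
    · rw [hz, mul_zero]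
      exact zero_le
    · obtain ⟨y, hyI, hyg⟩ : ∃ y ∈ I ∩ G.action.map v ⁻¹' I, G.Good y := by
        by_contra! hcon
        exact hz (measure_mono_null hcon (ae_iff.1 G.ae_good))
      obtain ⟨n, hn⟩ := SkyscraperGrids.exists_moves_translate (v : Fin d → ℤ) hyg
      obtain ⟨m, p, hp, w, hw, he⟩ := SkyscraperGrids.exists_eq_add_nsmul_of_moves
        hyI.1.2 hyI.2.2 hn v.2
      refine le_trans ?_ (ENNReal.le_tsum m)
      refine le_trans ?_ (Finset.single_le_sum (fun _ _ => zero_le) hp)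
      refine le_trans ?_ (Finset.single_le_sum (fun _ _ => zero_le) hw)
      rw [if_pos (show q m p w = v from he.symm)]
      exact mul_le_mul_right (measure_mono Set.inter_subset_left) _
  -- Each `u` matches at most one nonzero `v`, and none if `u = 0`.
  have hcollapse : ∀ u : Fin d → ℤ, ∑' v : {v : Fin d → ℤ // v ≠ 0},
      (if u = v then T.returnMeasure A v * G.measure I else 0) ≤
        T.returnMeasure A u * G.measure I := by
    intro u
    by_cases hu : u = 0
    · have : ∀ v : {v : Fin d → ℤ // v ≠ 0},
          (if u = v then T.returnMeasure A v * G.measure I else 0) = 0 := by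
        intro v
        rw [if_neg]
        rintro rfl
        exact v.2 hu
      simp [this]
    · rw [tsum_eq_single (⟨u, hu⟩ : {v : Fin d → ℤ // v ≠ 0})]
      · simp
      · exact fun v hv => if_neg fun he => hv (Subtype.ext he.symm)
  calc ∑' v : {v : Fin d → ℤ // v ≠ 0}, T.returnMeasure A v * G.action.returnMeasure I v
      ≤ ∑' v : {v : Fin d → ℤ // v ≠ 0}, ∑' n, ∑ p ∈ squareVectorFinset a,
          ∑ w ∈ centeredBox a (h n),
            if q n p w = v then T.returnMeasure A v * G.measure I else 0 :=
        ENNReal.tsum_le_tsum hterm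
    _ = ∑' n, ∑ p ∈ squareVectorFinset a, ∑ w ∈ centeredBox a (h n),
          ∑' v : {v : Fin d → ℤ // v ≠ 0},
            if q n p w = v then T.returnMeasure A v * G.measure I else 0 := by
        rw [ENNReal.tsum_comm]
        refine tsum_congr fun n => ?_
        rw [Summable.tsum_finsetSum fun _ _ => ENNReal.summable]
        exact Finset.sum_congr rfl fun p _ =>
          Summable.tsum_finsetSum fun _ _ => ENNReal.summable
    _ ≤ ∑' n, (∑ p ∈ squareVectorFinset a, ∑ w ∈ centeredBox a (h n),
          T.returnMeasure A (q n p w)) * G.measure I := by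
        refine ENNReal.tsum_le_tsum fun n => ?_
        simp only [Finset.sum_mul]
        exact Finset.sum_le_sum fun p _ => Finset.sum_le_sum fun w _ => hcollapse _
    _ ≤ ∑' n, δ n * G.measure I :=
        ENNReal.tsum_le_tsum fun n => mul_le_mul_left (hlt n).le _
    _ = (∑' n, δ n) * G.measure I := ENNReal.tsum_mul_right
    _ < μ A * G.measure I := by
        rw [mul_comm _ (G.measure I), mul_comm _ (G.measure I)]
        exact ENNReal.mul_lt_mul_right hIpos hItop hδA
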